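/- Let $G=(V,E)$ be a finite directed tree, i.e. an orientation of a finite undirected tree, and let $S\subseteq V$ be a set of sources and $R\subseteq V$ a set of receivers. Fix a field $F$ and nonzero coefficients $c_{uv}\in F$, one for each link $uv\in E$ (bitwise XOR coding is the case $F=\mathbb F_2$, $c_{uv}=1$). In an experiment each link $e$ works with probability $\alpha_e\in(0,1]$, independently of the other links. Each source $i\in S$ injects the unit vector $x_i\in F^{S}$, and each node adds up the packets arriving on its working incoming links (and its own probe, if it is a source), the packet arriving on $uv$ being multiplied by $c_{uv}$, and multicasts the result on all its outgoing links: the packet at $v$ is $$X_v=\mathbf 1[v\in S]\,x_v+\sum_{uv\in E,\ uv\text{ works}}c_{uv}X_u .$$ Let $P_\alpha$ be the distribution of the observation $(X_r)_{r\in R}\in (F^{S})^{R}$, for $\alpha=(\alpha_e)_{e\in E}$. A link $e$ is called identifiable if for all $\alpha,\alpha'\in(0,1]^{E}$, $P_\alpha=P_{\alpha'}$ implies $\alpha_e=\alpha'_e$. Theorem. A link $CD\in E$ is identifiable if and only if both of the following conditions hold (paths are directed; a path may consist of a single vertex). Condition 1. At least one of the following holds: (a) $C\in S$; (b) there are distinct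 $X_1,X_2\in S$ and edge-disjoint paths from $X_1$ to $C$ and from $X_2$ to $C$ that do not use the link $CD$; (c) there are $X_1\in S$, $X_2\in R$ and paths from $X_1$ to $C$ and from $C$ to $X_2$ that do not use $CD$. Condition 2. At least one of the following holds: (a) $D\in R$; (b) there are distinct $X_1,X_2\in R$ and edge-disjoint paths from $D$ to $X_1$ and from $D$ to $X_2$ that do not use the link $CD$; (c) there are $X_1\in S$, $X_2\in R$ and paths from $X_1$ to $D$ and from $D$ to $X_2$ that do not use $CD$. -/

import Mathlib

namespace LossTomography

/-- A directed tree: an orientation of a tree (no self-loops, no pair of opposite links, and the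
underlying undirected graph is connected and acyclic). -/
structure IsDirectedTree {V : Type*} (G : Digraph V) : Prop where
  asymm : ∀ u v : V, G.Adj u v → ¬ G.Adj v u
  isTree : G.toSimpleGraphInclusive.IsTree

/-- A nontrivial directed walk, viewed in the underlying graph, with all its darts oriented. -/
theorem IsDirectedTree.exists_walk {V : Type*} {G : Digraph V} (hG : IsDirectedTree G) {u v : V}
    (h : Relation.TransGen G.Adj u v) :
    ∃ p : G.toSimpleGraphInclusive.Walk u v, ¬ p.Nil ∧
      List.IsChain (fun a b : G.toSimpleGraphInclusive.Dart => a.snd = b.fst) p.darts ∧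
      ∀ d ∈ p.darts, G.Adj d.fst d.snd := by
  have adj : ∀ {a b : V}, G.Adj a b → G.toSimpleGraphInclusive.Adj a b := fun {a b} hab =>
    ⟨fun e => by subst e; exact hG.asymm _ _ hab hab, Or.inl hab⟩
  induction h using Relation.TransGen.head_induction_on with
  | single h =>
    exact ⟨SimpleGraph.Walk.cons (adj h) SimpleGraph.Walk.nil, by simp, by simp, by simpa using h⟩
  | head h _ ih =>
    obtain ⟨p, _, _, hp⟩ := ih
    refine ⟨SimpleGraph.Walk.cons (adj h) p, by simp, SimpleGraph.Walk.isChain_dartAdj_darts _, ?_⟩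
    intro d hd
    rw [SimpleGraph.Walk.darts_cons, List.mem_cons] at hd
    rcases hd with rfl | hd
    · exact h
    · exact hp d hd

/-- Following the links of a finite directed tree backwards always terminates. -/
theorem IsDirectedTree.wellFounded {V : Type*} [Finite V] {G : Digraph V}
    (hG : IsDirectedTree G) : WellFounded G.Adj := by
  have irrefl : ∀ u : V, ¬ Relation.TransGen G.Adj u u := by
    intro u h
    obtain ⟨p, hp, hc, hd⟩ := hG.exists_walk h
    have hpath : p.IsPath := by
      rw [hG.isTree.isAcyclic.isPath_iff_isChain, SimpleGraph.Walk.edges, List.isChain_map]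
      rw [List.isChain_iff_getElem] at hc ⊢
      intro i hi heq
      have h1 := hc i hi
      have a1 := hd _ (List.getElem_mem (l := p.darts) (n := i) (by omega))
      have a2 := hd _ (List.getElem_mem (l := p.darts) (n := i + 1) hi)
      rw [SimpleGraph.dart_edge_eq_iff] at heq
      rcases heq with heq | heq
      · rw [← heq] at h1
        rw [h1] at a1
        exact hG.asymm _ _ a1 a1
      · rw [heq] at a1
        exact hG.asymm _ _ a2 a1
    rw [SimpleGraph.Walk.isPath_iff_nil] at hpath
    exact hp hpath
  have : Std.Irrefl (Relation.TransGen G.Adj) := ⟨irrefl⟩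
  have wf : WellFounded (Relation.TransGen G.Adj) := Finite.wellFounded_of_trans_of_irrefl _
  exact Subrelation.wf (fun h => Relation.TransGen.single h) wf

/-- The links of the network. -/
abbrev Link {V : Type*} (G : Digraph V) : Type _ := {e : V × V // G.Adj e.1 e.2}

/-- The packet present at each node when `W` tells which links work, as the vector of its symbols
indexed by the sources; `0` means that no packet is present. Source `i` injects the `i`-th unit
vector, and every node adds up the packets that arrive on its incoming links, the packet on the
link `uv` being scaled by `c u v`, and multicasts the result on all its outgoing links. -/
noncomputable def packet {V F : Type*} [Fintype V] [DecidableEq V] [Field F]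
    (G : Digraph V) [DecidableRel G.Adj] (hG : IsDirectedTree G) (S : Finset V)
    (c : V → V → F) (W : Link G → Bool) : V → (S → F) :=
  hG.wellFounded.fix fun v X i =>
    (if (i : V) = v then 1 else 0) +
      ∑ u : {u : V // G.Adj u v}, if W ⟨(u, v), u.2⟩ then c u v * X u u.2 i else 0

theorem packet_eq {V F : Type*} [Fintype V] [DecidableEq V] [Field F]
    (G : Digraph V) [DecidableRel G.Adj] (hG : IsDirectedTree G) (S : Finset V)
    (c : V → V → F) (W : Link G → Bool) (v : V) (i : S) :
    packet G hG S c W v i = (if (i : V) = v then 1 else 0) +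
      ∑ u : {u : V // G.Adj u v}, if W ⟨(u, v), u.2⟩ then c u v * packet G hG S c W u i else 0 := by
  unfold packet
  rw [WellFounded.fix_eq]

/-- The packets collected at the receivers. -/
noncomputable def observation {V F : Type*} [Fintype V] [DecidableEq V] [Field F]
    (G : Digraph V) [DecidableRel G.Adj] (hG : IsDirectedTree G) (S R : Finset V)
    (c : V → V → F) (W : Link G → Bool) : R → S → F :=
  fun r => packet G hG S c W r

/-- The probability that exactly the links `e` with `W e = true` work, when the links work
independently, link `e` with probability `α e`. -/
def stateProb {V : Type*} [Fintype V] (G : Digraph V) [DecidableRel G.Adj]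
    (α : Link G → ℝ) (W : Link G → Bool) : ℝ :=
  ∏ e : Link G, if W e then α e else 1 - α e

/-- The distribution of the observations, as a probability mass function. -/
noncomputable def obsProb {V F : Type*} [Fintype V] [DecidableEq V] [Field F] [DecidableEq F]
    (G : Digraph V) [DecidableRel G.Adj] (hG : IsDirectedTree G) (S R : Finset V)
    (c : V → V → F) (α : Link G → ℝ) (x : R → S → F) : ℝ :=
  ∑ W : Link G → Bool, if observation G hG S R c W = x then stateProb G α W else 0

/-- The link `e` is identifiable: the distribution of the observations determines its success
probability, all success probabilities being in `(0, 1]`. -/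
def IsIdentifiable {V F : Type*} [Fintype V] [DecidableEq V] [Field F] [DecidableEq F]
    (G : Digraph V) [DecidableRel G.Adj] (hG : IsDirectedTree G) (S R : Finset V)
    (c : V → V → F) (e : Link G) : Prop :=
  ∀ α α' : Link G → ℝ, (∀ l, α l ∈ Set.Ioc (0 : ℝ) 1) → (∀ l, α' l ∈ Set.Ioc (0 : ℝ) 1) →
    obsProb G hG S R c α = obsProb G hG S R c α' → α e = α' e

/-- `p` lists the vertices of a directed path from `u` to `v` (of one vertex if `u = v`). -/
structure IsDiPath {V : Type*} (G : Digraph V) (u v : V) (p : List V) : Prop where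
  chain : p.IsChain G.Adj
  nodup : p.Nodup
  head : p.head? = some u
  last : p.getLast? = some v

/-- The ordered pairs of consecutive vertices of a list, that is, the links of a path. -/
def pathLinks {V : Type*} (p : List V) : List (V × V) := p.zip p.tail

/-- The condition on the tail `C` of the link `CD`. -/
def TailCondition {V : Type*} (G : Digraph V) (S R : Finset V) (C D : V) : Prop :=
  C ∈ S ∨
  (∃ X₁ ∈ S, ∃ X₂ ∈ S, X₁ ≠ X₂ ∧ ∃ p₁ p₂ : List V, IsDiPath G X₁ C p₁ ∧ IsDiPath G X₂ C p₂ ∧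
    (pathLinks p₁).Disjoint (pathLinks p₂) ∧ (C, D) ∉ pathLinks p₁ ∧ (C, D) ∉ pathLinks p₂) ∨
  (∃ X₁ ∈ S, ∃ X₂ ∈ R, ∃ p₁ p₂ : List V, IsDiPath G X₁ C p₁ ∧ IsDiPath G C X₂ p₂ ∧
    (C, D) ∉ pathLinks p₁ ∧ (C, D) ∉ pathLinks p₂)

/-- The condition on the head `D` of the link `CD`. -/
def HeadCondition {V : Type*} (G : Digraph V) (S R : Finset V) (C D : V) : Prop :=
  D ∈ R ∨
  (∃ X₁ ∈ R, ∃ X₂ ∈ R, X₁ ≠ X₂ ∧ ∃ p₁ p₂ : List V, IsDiPath G D X₁ p₁ ∧ IsDiPath G D X₂ p₂ ∧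
    (pathLinks p₁).Disjoint (pathLinks p₂) ∧ (C, D) ∉ pathLinks p₁ ∧ (C, D) ∉ pathLinks p₂) ∨
  (∃ X₁ ∈ S, ∃ X₂ ∈ R, ∃ p₁ p₂ : List V, IsDiPath G X₁ D p₁ ∧ IsDiPath G D X₂ p₂ ∧
    (C, D) ∉ pathLinks p₁ ∧ (C, D) ∉ pathLinks p₂)

end LossTomography

/-! In a tree there is at most one directed path between two vertices. So the symbol of source `s`
at receiver `r` is a fixed nonzero scalar when every link of the path from `s` to `r` works, and 0
otherwise: cancellation never occurs, and observing amounts to knowing which source-receiver paths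
work (`exists_packet_eq_ite`, `observation_congr`). Sufficiency: for every union `M` of such paths,
the distribution fixes the probability that all of `M` works, which is the product of `α` over `M`
(`Observable.prod_eq`). Since all factors are nonzero, fixed products can be divided: from `M`, `N`
and `M ∪ N` one gets `M ∩ N`, and a disjoint factor can be removed. The tail condition strips off
everything upstream of the link (`TailCondition.prod_eq`), and the head condition everything
downstream. Necessity: a link on no source-receiver path has no influence. If the link is used but a
condition fails, some adjacent link lies on exactly the same source-receiver paths, and swapping the
two probabilities is invisible (`not_isIdentifiable_of_twin`). -/

namespace LossTomography

open Relation

/-! ### Uniqueness of directed paths in an oriented tree. -/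

section Tree

variable {V : Type*} {G : Digraph V}

theorem IsDirectedTree.adj_inclusive (hG : IsDirectedTree G) {a b : V} (hab : G.Adj a b) :
    G.toSimpleGraphInclusive.Adj a b :=
  ⟨fun e => by subst e; exact hG.asymm _ _ hab hab, Or.inl hab⟩

/-- A walk in the underlying tree that follows the orientation is a path. -/
theorem IsDirectedTree.isPath_of_oriented (hG : IsDirectedTree G) {u v : V}
    (p : G.toSimpleGraphInclusive.Walk u v) (hd : ∀ d ∈ p.darts, G.Adj d.fst d.snd) :
    p.IsPath := by
  have hc := SimpleGraph.Walk.isChain_dartAdj_darts p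
  rw [hG.isTree.isAcyclic.isPath_iff_isChain, SimpleGraph.Walk.edges, List.isChain_map]
  rw [List.isChain_iff_getElem] at hc ⊢
  intro i hi heq
  have h1 : p.darts[i].snd = p.darts[i + 1].fst := hc i hi
  have a1 := hd _ (List.getElem_mem (l := p.darts) (n := i) (by omega))
  have a2 := hd _ (List.getElem_mem (l := p.darts) (n := i + 1) hi)
  rw [SimpleGraph.dart_edge_eq_iff] at heq
  rcases heq with heq | heq
  · rw [← heq] at h1
    rw [h1] at a1
    exact hG.asymm _ _ a1 a1
  · rw [heq] at a1
    exact hG.asymm _ _ a2 a1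

theorem IsDirectedTree.exists_oriented_walk (hG : IsDirectedTree G) {u v : V}
    (h : ReflTransGen G.Adj u v) :
    ∃ p : G.toSimpleGraphInclusive.Walk u v, ∀ d ∈ p.darts, G.Adj d.fst d.snd := by
  rcases reflTransGen_iff_eq_or_transGen.mp h with rfl | h
  · exact ⟨.nil, by simp⟩
  · obtain ⟨p, _, _, hp⟩ := hG.exists_walk h
    exact ⟨p, hp⟩

/-- Both extended walks are the unique tree path from `i` to `v`, so their penultimate vertices
agree. -/
theorem IsDirectedTree.pred_unique (hG : IsDirectedTree G) {i u u' v : V}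
    (hu : ReflTransGen G.Adj i u) (huv : G.Adj u v) (hu' : ReflTransGen G.Adj i u')
    (huv' : G.Adj u' v) : u = u' := by
  obtain ⟨p, hp⟩ := hG.exists_oriented_walk hu
  obtain ⟨q, hq⟩ := hG.exists_oriented_walk hu'
  have hp' := hG.isPath_of_oriented (p.concat (hG.adj_inclusive huv)) (by
    intro d hd
    rw [SimpleGraph.Walk.darts_concat, List.concat_eq_append, List.mem_append] at hd
    rcases hd with hd | hd
    · exact hp d hd
    · rw [List.mem_singleton] at hd; subst hd; exact huv)
  have hq' := hG.isPath_of_oriented (q.concat (hG.adj_inclusive huv')) (by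
    intro d hd
    rw [SimpleGraph.Walk.darts_concat, List.concat_eq_append, List.mem_append] at hd
    rcases hd with hd | hd
    · exact hq d hd
    · rw [List.mem_singleton] at hd; subst hd; exact huv')
  have h := congrArg (fun w => w.1.penultimate)
    ((hG.isTree.isAcyclic.subsingleton_path _ _).elim ⟨_, hp'⟩ ⟨_, hq'⟩)
  simpa using h

theorem IsDirectedTree.succ_unique (hG : IsDirectedTree G) {v u u' r : V}
    (hvu : G.Adj v u) (hu : ReflTransGen G.Adj u r) (hvu' : G.Adj v u')
    (hu' : ReflTransGen G.Adj u' r) : u = u' := by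
  obtain ⟨p, hp⟩ := hG.exists_oriented_walk hu
  obtain ⟨q, hq⟩ := hG.exists_oriented_walk hu'
  have hp' := hG.isPath_of_oriented (.cons (hG.adj_inclusive hvu) p) (by
    intro d hd
    rw [SimpleGraph.Walk.darts_cons, List.mem_cons] at hd
    rcases hd with rfl | hd
    · exact hvu
    · exact hp d hd)
  have hq' := hG.isPath_of_oriented (.cons (hG.adj_inclusive hvu') q) (by
    intro d hd
    rw [SimpleGraph.Walk.darts_cons, List.mem_cons] at hd
    rcases hd with rfl | hd
    · exact hvu'
    · exact hq d hd)
  have h := congrArg (fun w => w.1.snd)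
    ((hG.isTree.isAcyclic.subsingleton_path _ _).elim ⟨_, hp'⟩ ⟨_, hq'⟩)
  simpa using h

theorem IsDirectedTree.not_adj_of_reflTransGen [Finite V] (hG : IsDirectedTree G) {u v : V}
    (h : ReflTransGen G.Adj u v) : ¬ G.Adj v u := fun hvu =>
  hG.wellFounded.transGen.irrefl.irrefl _ (TransGen.tail' h hvu)

theorem IsDirectedTree.not_reachable_deleteEdges (hG : IsDirectedTree G) {C D : V}
    (hCD : G.Adj C D) : ¬ (G.toSimpleGraphInclusive.deleteEdges {s(C, D)}).Reachable C D := by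
  have := SimpleGraph.isAcyclic_iff_forall_adj_isBridge.mp hG.isTree.isAcyclic
    (hG.adj_inclusive hCD)
  rw [SimpleGraph.isBridge_iff] at this
  exact this

theorem pathLinks_cons_cons (a b : V) (l : List V) :
    pathLinks (a :: b :: l) = (a, b) :: pathLinks (b :: l) := rfl

theorem pathLinks_append_singleton {p : List V} {v : V} (hv : p.getLast? = some v) (w : V) :
    pathLinks (p ++ [w]) = pathLinks p ++ [(v, w)] := by
  induction p with
  | nil => simp at hv
  | cons a l ih =>
    cases l with
    | nil => simp at hv; subst hv; rfl
    | cons b l =>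
      have := ih (by simpa [List.getLast?_cons_cons] using hv)
      rw [List.cons_append, List.cons_append, pathLinks_cons_cons, pathLinks_cons_cons,
        ← List.cons_append, this, List.cons_append]

end Tree

/-! ### Directed walks as sets of links. -/

section LinkPath

variable {V : Type*} [DecidableEq V] {G : Digraph V}

/-- `M` is the set of links of a directed walk from `u` to `v`. -/
inductive LinkPath (G : Digraph V) (u : V) : V → Finset (Link G) → Prop
  | refl : LinkPath G u u ∅
  | tail {v w : V} {M : Finset (Link G)} (h : LinkPath G u v M) (hvw : G.Adj v w) :
      LinkPath G u w (insert ⟨(v, w), hvw⟩ M)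

namespace LinkPath

theorem trans {u v w : V} {M N : Finset (Link G)} (h : LinkPath G u v M)
    (h' : LinkPath G v w N) : LinkPath G u w (M ∪ N) := by
  induction h' with
  | refl => simpa using h
  | tail _ hvw ih => rw [Finset.union_insert]; exact ih.tail hvw

theorem single {u v : V} (h : G.Adj u v) : LinkPath G u v {⟨(u, v), h⟩} := by
  rw [← insert_empty_eq]
  exact LinkPath.refl.tail h

theorem head {u v w : V} {M : Finset (Link G)} (h : G.Adj u v) (h' : LinkPath G v w M) :
    LinkPath G u w (insert ⟨(u, v), h⟩ M) := by
  rw [Finset.insert_eq]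
  exact (single h).trans h'

theorem reflTransGen {u v : V} {M : Finset (Link G)} (h : LinkPath G u v M) :
    ReflTransGen G.Adj u v := by
  induction h with
  | refl => exact .refl
  | tail _ hvw ih => exact ih.tail hvw

theorem exists_of_reflTransGen {u v : V} (h : ReflTransGen G.Adj u v) :
    ∃ M, LinkPath G u v M := by
  induction h with
  | refl => exact ⟨_, .refl⟩
  | tail _ hvw ih => exact ih.elim fun M hM => ⟨_, hM.tail hvw⟩

theorem eq_or_exists_head {u v : V} {M : Finset (Link G)} (h : LinkPath G u v M) :
    (u = v ∧ M = ∅) ∨ ∃ (w : V) (N : Finset (Link G)) (huw : G.Adj u w), LinkPath G w v N ∧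
      M = insert ⟨(u, w), huw⟩ N := by
  induction h with
  | refl => exact .inl ⟨rfl, rfl⟩
  | @tail v w M h hvw ih =>
    rcases ih with ⟨rfl, rfl⟩ | ⟨x, N, hux, hN, rfl⟩
    · exact .inr ⟨w, ∅, hvw, .refl, rfl⟩
    · exact .inr ⟨x, _, hux, hN.tail hvw, Finset.insert_comm _ _ _⟩

theorem split {u v : V} {M : Finset (Link G)} (h : LinkPath G u v M) {e : Link G} (he : e ∈ M) :
    ∃ M₁ M₂, LinkPath G u e.1.1 M₁ ∧ LinkPath G e.1.2 v M₂ ∧ M = insert e (M₁ ∪ M₂) := by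
  induction h with
  | refl => simp at he
  | @tail x w M h hvw ih =>
    rcases Finset.mem_insert.mp he with rfl | he
    · exact ⟨M, ∅, h, .refl, by simp⟩
    · obtain ⟨M₁, M₂, h₁, h₂, rfl⟩ := ih he
      exact ⟨M₁, _, h₁, h₂.tail hvw, by ext; simp; tauto⟩

theorem of_isDiPath {u v : V} {p : List V} (h : IsDiPath G u v p) :
    ∃ M, LinkPath G u v M ∧ ∀ e : Link G, e ∈ M ↔ e.1 ∈ pathLinks p := by
  obtain ⟨hc, -, hh, hl⟩ := h
  induction p generalizing u with
  | nil => simp at hh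
  | cons a l ih =>
    simp only [List.head?_cons, Option.some.injEq] at hh
    subst hh
    cases l with
    | nil =>
      simp only [List.getLast?_singleton, Option.some.injEq] at hl
      subst hl
      exact ⟨∅, .refl, by simp [pathLinks]⟩
    | cons b l =>
      rw [List.isChain_cons_cons] at hc
      obtain ⟨M, hM, hM'⟩ := ih (u := b) hc.2 rfl (by simpa [List.getLast?_cons_cons] using hl)
      refine ⟨_, hM.head hc.1, fun e => ?_⟩
      rw [Finset.mem_insert, hM', pathLinks_cons_cons, List.mem_cons, Subtype.ext_iff]

theorem exists_isDiPath [Finite V] (hG : IsDirectedTree G) {u v : V} {M : Finset (Link G)}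
    (h : LinkPath G u v M) : ∃ p, IsDiPath G u v p ∧ ∀ x ∈ pathLinks p, ∃ e ∈ M, e.1 = x := by
  suffices ∃ p, IsDiPath G u v p ∧ (∀ x ∈ pathLinks p, ∃ e ∈ M, e.1 = x) ∧
      ∀ x ∈ p, ReflTransGen G.Adj x v from
    this.imp fun p hp => ⟨hp.1, hp.2.1⟩
  induction h with
  | refl => exact ⟨[u], ⟨by simp, by simp, by simp, by simp⟩, by simp [pathLinks],
      by simp [ReflTransGen.refl]⟩
  | @tail v w M h hvw ih =>
    obtain ⟨p, ⟨hc, hn, hh, hl⟩, hM, hp⟩ := ih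
    refine ⟨p ++ [w], ⟨?_, ?_, ?_, by simp⟩, ?_, ?_⟩
    · rw [List.isChain_append]
      refine ⟨hc, by simp, ?_⟩
      simp [hl, hvw]
    · rw [List.nodup_append]
      refine ⟨hn, by simp, ?_⟩
      rintro a ha b hb rfl
      rw [List.mem_singleton] at hb
      subst hb
      exact hG.not_adj_of_reflTransGen (hp _ ha) hvw
    · simp [List.head?_append, hh]
    · intro x hx
      rw [pathLinks_append_singleton hl, List.mem_append, List.mem_singleton] at hx
      rcases hx with hx | rfl
      · obtain ⟨e, he, rfl⟩ := hM x hx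
        exact ⟨e, Finset.mem_insert_of_mem he, rfl⟩
      · exact ⟨_, Finset.mem_insert_self _ _, rfl⟩
    · intro x hx
      rcases List.mem_append.mp hx with hx | hx
      · exact (hp x hx).tail hvw
      · rw [List.mem_singleton] at hx; subst hx; exact .refl

/-- Every link of the tree is a bridge, so a walk avoiding `CD` stays on one side of it; this later
gives disjointness of link sets. -/
theorem reachable_deleteEdges (hG : IsDirectedTree G) {C D : V} (hCD : G.Adj C D) {u v : V}
    {M : Finset (Link G)} (h : LinkPath G u v M) (hM : ⟨(C, D), hCD⟩ ∉ M) :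
    (G.toSimpleGraphInclusive.deleteEdges {s(C, D)}).Reachable u v ∧
      ∀ e ∈ M, (G.toSimpleGraphInclusive.deleteEdges {s(C, D)}).Reachable u e.1.1 := by
  induction h with
  | refl => simp
  | @tail v w M h hvw ih =>
    rw [Finset.mem_insert, not_or] at hM
    obtain ⟨h₁, h₂⟩ := ih hM.2
    refine ⟨h₁.trans (SimpleGraph.Adj.reachable ?_), fun e he => ?_⟩
    · rw [SimpleGraph.deleteEdges_adj]
      refine ⟨hG.adj_inclusive hvw, ?_⟩
      rw [Set.mem_singleton_iff, Sym2.eq_iff]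
      rintro (⟨rfl, rfl⟩ | ⟨rfl, rfl⟩)
      · exact hM.1 rfl
      · exact hG.asymm _ _ hCD hvw
    · rcases Finset.mem_insert.mp he with rfl | he
      · exact h₁
      · exact h₂ e he

end LinkPath

end LinkPath

/-! ### Observations as indicators of working paths. -/

section Packet

variable {V F : Type*} [Fintype V] [DecidableEq V] [Field F]
  {G : Digraph V} [DecidableRel G.Adj] (hG : IsDirectedTree G) {S R : Finset V} {c : V → V → F}

theorem packet_eq_zero (W : Link G → Bool) {v : V} {i : S}
    (h : ¬ ReflTransGen G.Adj (i : V) v) : packet G hG S c W v i = 0 := by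
  induction v using hG.wellFounded.induction with
  | _ v ih =>
    rw [packet_eq, if_neg, zero_add]
    · refine Finset.sum_eq_zero fun u _ => ?_
      rw [ih u u.2 fun hu => h (hu.tail u.2)]
      simp
    · rintro h'
      exact h (h' ▸ .refl)

/-- The symbol of source `i` at `v` is a fixed nonzero scalar if all links of the path from `i`
to `v` work, and `0` otherwise. -/
theorem exists_packet_eq_ite (hc : ∀ u v : V, G.Adj u v → c u v ≠ 0) {i : S} {v : V}
    {M : Finset (Link G)} (h : LinkPath G (i : V) v M) :
    ∃ k : F, k ≠ 0 ∧ ∀ W : Link G → Bool,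
      packet G hG S c W v i = if ∀ e ∈ M, W e = true then k else 0 := by
  induction h with
  | refl =>
    refine ⟨1, one_ne_zero, fun W => ?_⟩
    rw [packet_eq, if_pos rfl, if_pos (by simp), Finset.sum_eq_zero, add_zero]
    intro u _
    rw [packet_eq_zero hG W fun hu => hG.not_adj_of_reflTransGen hu u.2]
    simp
  | @tail u w M h huw ih =>
    obtain ⟨k, hk, hW⟩ := ih
    refine ⟨c u w * k, mul_ne_zero (hc _ _ huw) hk, fun W => ?_⟩
    -- By `pred_unique`, the symbol of `i` can enter `w` only through `u`.
    rw [packet_eq, if_neg, zero_add, Finset.sum_eq_single ⟨u, huw⟩]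
    · simp only [hW, Finset.forall_mem_insert]
      split_ifs <;> simp_all
    · intro u' _ hne
      rw [packet_eq_zero hG W]
      · simp
      · exact fun hu' => hne (Subtype.ext (hG.pred_unique hu' u'.2 h.reflTransGen huw))
    · simp
    · intro hi
      exact hG.not_adj_of_reflTransGen h.reflTransGen (hi ▸ huw)

theorem observation_congr (hc : ∀ u v : V, G.Adj u v → c u v ≠ 0) {W W' : Link G → Bool}
    (h : ∀ s ∈ S, ∀ r ∈ R, ∀ M, LinkPath G s r M →
      ((∀ e ∈ M, W e = true) ↔ ∀ e ∈ M, W' e = true)) :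
    observation G hG S R c W = observation G hG S R c W' := by
  funext r i
  unfold observation
  by_cases hr : ReflTransGen G.Adj (i : V) r
  · obtain ⟨M, hM⟩ := LinkPath.exists_of_reflTransGen hr
    obtain ⟨k, _, hk⟩ := exists_packet_eq_ite hG hc hM
    rw [hk, hk]
    exact if_congr (h i i.2 r r.2 M hM) rfl rfl
  · rw [packet_eq_zero hG W hr, packet_eq_zero hG W' hr]

variable (S R c) in
/-- Whether all links of `M` work can be told from the observation. -/
def Observable (M : Finset (Link G)) : Prop :=
  ∃ Q : (R → S → F) → Prop, ∀ W, Q (observation G hG S R c W) ↔ ∀ e ∈ M, W e = true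

theorem LinkPath.observable (hc : ∀ u v : V, G.Adj u v → c u v ≠ 0) {s r : V} (hs : s ∈ S)
    (hr : r ∈ R) {M : Finset (Link G)} (h : LinkPath G s r M) : Observable hG S R c M := by
  obtain ⟨k, hk, hW⟩ := exists_packet_eq_ite (i := ⟨s, hs⟩) hG hc h
  refine ⟨fun x => x ⟨r, hr⟩ ⟨s, hs⟩ ≠ 0, fun W => ?_⟩
  simp only [observation, hW]
  simp [hk]

variable {hG} in
theorem Observable.union {M N : Finset (Link G)} (hM : Observable hG S R c M)
    (hN : Observable hG S R c N) : Observable hG S R c (M ∪ N) := by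
  obtain ⟨P, hP⟩ := hM
  obtain ⟨Q, hQ⟩ := hN
  exact ⟨fun x => P x ∧ Q x, fun W =>
    (and_congr (hP W) (hQ W)).trans Finset.forall_mem_union.symm⟩

end Packet

/-! ### Products of success probabilities determined by the distribution. -/

section Probability

variable {V F : Type*} [Fintype V] [DecidableEq V] [Field F] [DecidableEq F]
  {G : Digraph V} [DecidableRel G.Adj] {hG : IsDirectedTree G} {S R : Finset V} {c : V → V → F}

/-- The probability that all links of `M` work. -/
theorem sum_stateProb_of_forall (α : Link G → ℝ) (M : Finset (Link G)) :
    ∑ W : Link G → Bool, (if ∀ e ∈ M, W e = true then stateProb G α W else 0) =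
      ∏ e ∈ M, α e := by
  -- Giving failure of a link of `M` weight 0 kills the unwanted states when the product of sums is
  -- expanded.
  have h := Finset.prod_univ_sum (fun _ : Link G => (Finset.univ : Finset Bool))
    (fun e b => if b then α e else if e ∈ M then 0 else 1 - α e)
  rw [Fintype.piFinset_univ] at h
  trans ∏ e : Link G, ∑ b : Bool, (if b then α e else if e ∈ M then 0 else 1 - α e)
  · rw [h]
    refine Finset.sum_congr rfl fun W _ => ?_
    split_ifs with hW
    · refine Finset.prod_congr rfl fun e _ => ?_
      by_cases he : e ∈ M
      · simp [hW e he]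
      · simp [he]
    · push Not at hW
      obtain ⟨e, he, hWe⟩ := hW
      exact (Finset.prod_eq_zero (Finset.mem_univ e) (by simp [hWe, he])).symm
  · rw [← Finset.prod_subset (Finset.subset_univ M)]
    · exact Finset.prod_congr rfl fun e he => by simp [he]
    · intro e _ he
      simp [he]

theorem sum_stateProb (α : Link G → ℝ) : ∑ W : Link G → Bool, stateProb G α W = 1 := by
  simpa using sum_stateProb_of_forall α ∅

theorem sum_stateProb_eq_of_obsProb_eq {α α' : Link G → ℝ}
    (h : obsProb G hG S R c α = obsProb G hG S R c α') (Q : (R → S → F) → Prop)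
    [DecidablePred Q] :
    ∑ W, (if Q (observation G hG S R c W) then stateProb G α W else 0) =
      ∑ W, (if Q (observation G hG S R c W) then stateProb G α' W else 0) := by
  have key : ∀ β : Link G → ℝ,
      ∑ W, (if Q (observation G hG S R c W) then stateProb G β W else 0) =
        -- The field may be infinite, so the sum runs over the finitely many attained observations.
        ∑ x ∈ Finset.univ.image (observation G hG S R c),
          if Q x then obsProb G hG S R c β x else 0 := by
    intro β
    rw [← Finset.sum_fiberwise_of_maps_to
      (fun W _ => Finset.mem_image_of_mem (observation G hG S R c) (Finset.mem_univ W))]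
    refine Finset.sum_congr rfl fun x _ => ?_
    rw [Finset.sum_filter, obsProb]
    split_ifs with hx
    · refine Finset.sum_congr rfl fun W _ => ?_
      by_cases hW : observation G hG S R c W = x
      · simp [hW, hx]
      · simp [hW]
    · refine Finset.sum_eq_zero fun W _ => ?_
      by_cases hW : observation G hG S R c W = x
      · simp [hW, hx]
      · simp [hW]
  rw [key, key, h]

theorem Observable.prod_eq {α α' : Link G → ℝ}
    (h : obsProb G hG S R c α = obsProb G hG S R c α') {M : Finset (Link G)}
    (hM : Observable hG S R c M) : ∏ e ∈ M, α e = ∏ e ∈ M, α' e := by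
  classical
  obtain ⟨Q, hQ⟩ := hM
  rw [← sum_stateProb_of_forall, ← sum_stateProb_of_forall]
  simpa only [hQ] using sum_stateProb_eq_of_obsProb_eq h Q

end Probability

/-! ### The two conditions imply identifiability. -/

section Sufficiency

variable {V F : Type*} [Fintype V] [DecidableEq V] [Field F] [DecidableEq F]
  {G : Digraph V} [DecidableRel G.Adj] {hG : IsDirectedTree G} {S R : Finset V} {c : V → V → F}
  {α α' : Link G → ℝ}

theorem prod_inter_eq {ι : Type*} [DecidableEq ι] {α α' : ι → ℝ} (hα' : ∀ l, α' l ≠ 0)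
    {M N : Finset ι} (hM : ∏ e ∈ M, α e = ∏ e ∈ M, α' e) (hN : ∏ e ∈ N, α e = ∏ e ∈ N, α' e)
    (hMN : ∏ e ∈ M ∪ N, α e = ∏ e ∈ M ∪ N, α' e) :
    ∏ e ∈ M ∩ N, α e = ∏ e ∈ M ∩ N, α' e := by
  have h := Finset.prod_union_inter (s₁ := M) (s₂ := N) (f := α)
  rw [hM, hN, hMN, ← Finset.prod_union_inter (f := α')] at h
  exact mul_left_cancel₀ (Finset.prod_ne_zero_iff.mpr fun e _ => hα' e) h

theorem prod_eq_of_disjoint {ι : Type*} [DecidableEq ι] {α α' : ι → ℝ} (hα' : ∀ l, α' l ≠ 0)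
    {M N : Finset ι} (hd : Disjoint M N) (hN : ∏ e ∈ N, α e = ∏ e ∈ N, α' e)
    (hMN : ∏ e ∈ M ∪ N, α e = ∏ e ∈ M ∪ N, α' e) : ∏ e ∈ M, α e = ∏ e ∈ M, α' e := by
  rw [Finset.prod_union hd, Finset.prod_union hd, hN] at hMN
  exact mul_right_cancel₀ (Finset.prod_ne_zero_iff.mpr fun e _ => hα' e) hMN

/-- Under the tail condition, a set of links on the side of `D` is determined as soon as it can be
observed together with the links of any path from a source to `C`. -/
theorem TailCondition.prod_eq (hc : ∀ u v : V, G.Adj u v → c u v ≠ 0)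
    (h : obsProb G hG S R c α = obsProb G hG S R c α') (hα' : ∀ l, α' l ≠ 0) {C D : V}
    (hCD : G.Adj C D) (ht : TailCondition G S R C D) {X : Finset (Link G)}
    (hX : ∀ e ∈ X, e = ⟨(C, D), hCD⟩ ∨
      ¬ (G.toSimpleGraphInclusive.deleteEdges {s(C, D)}).Reachable C e.1.1)
    (hobs : ∀ s ∈ S, ∀ Q, LinkPath G s C Q → Observable hG S R c (Q ∪ X)) :
    ∏ e ∈ X, α e = ∏ e ∈ X, α' e := by
  rcases ht with hC | ⟨s₁, hs₁, s₂, hs₂, -, p₁, p₂, hp₁, hp₂, hdisj, -, -⟩ |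
    ⟨s, hs, r, hr, p₁, p₂, hp₁, hp₂, hn₁, hn₂⟩
  · have := hobs C hC ∅ .refl
    rw [Finset.empty_union] at this
    exact this.prod_eq h
  · obtain ⟨Q₁, hQ₁, hm₁⟩ := LinkPath.of_isDiPath hp₁
    obtain ⟨Q₂, hQ₂, hm₂⟩ := LinkPath.of_isDiPath hp₂
    have hd : Q₁ ∩ Q₂ = ∅ := by
      rw [← Finset.disjoint_iff_inter_eq_empty, Finset.disjoint_left]
      intro e he₁ he₂
      exact hdisj ((hm₁ e).mp he₁) ((hm₂ e).mp he₂)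
    have o₁ := hobs s₁ hs₁ Q₁ hQ₁
    have o₂ := hobs s₂ hs₂ Q₂ hQ₂
    -- The intersection of `Q₁ ∪ X` and `Q₂ ∪ X` is `X`, as `Q₁` and `Q₂` are disjoint.
    have := prod_inter_eq hα' (o₁.prod_eq h) (o₂.prod_eq h) ((o₁.union o₂).prod_eq h)
    rwa [← Finset.inter_union_distrib_right, hd, Finset.empty_union] at this
  · obtain ⟨Q, hQ, hmQ⟩ := LinkPath.of_isDiPath hp₁
    obtain ⟨B, hB, hmB⟩ := LinkPath.of_isDiPath hp₂
    have hQ' : ⟨(C, D), hCD⟩ ∉ Q := fun he => hn₁ ((hmQ _).mp he)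
    have hB' : ⟨(C, D), hCD⟩ ∉ B := fun he => hn₂ ((hmB _).mp he)
    have oY := (hQ.trans hB).observable hG hc hs hr
    have oX := (hobs s hs Q hQ).union oY
    -- `Q ∪ B` is itself a source-receiver path on the side of `C`, so its product can be divided
    -- out.
    refine prod_eq_of_disjoint hα' (N := Q ∪ B) ?_ (oY.prod_eq h) ?_
    · rw [Finset.disjoint_left]
      intro e he heQB
      rcases hX e he with rfl | hne
      · rcases Finset.mem_union.mp heQB with h' | h'
        exacts [hQ' h', hB' h']
      · apply hne
        rcases Finset.mem_union.mp heQB with h' | h'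
        · obtain ⟨h₁, h₂⟩ := hQ.reachable_deleteEdges hG hCD hQ'
          exact h₁.symm.trans (h₂ e h')
        · exact (hB.reachable_deleteEdges hG hCD hB').2 e h'
    · have e : Q ∪ X ∪ (Q ∪ B) = X ∪ (Q ∪ B) := by ext; simp; tauto
      rw [← e]
      exact oX.prod_eq h

theorem isIdentifiable_of_conditions (hc : ∀ u v : V, G.Adj u v → c u v ≠ 0) {C D : V}
    (hCD : G.Adj C D) (ht : TailCondition G S R C D) (hh : HeadCondition G S R C D) :
    IsIdentifiable G hG S R c ⟨(C, D), hCD⟩ := by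
  intro α α' _ hα' h
  replace hα' : ∀ l, α' l ≠ 0 := fun l => (hα' l).1.ne'
  have hside := hG.not_reachable_deleteEdges hCD
  have side : ∀ {r : V} {A : Finset (Link G)}, LinkPath G D r A → ⟨(C, D), hCD⟩ ∉ A →
      ∀ e ∈ A, ¬ (G.toSimpleGraphInclusive.deleteEdges {s(C, D)}).Reachable C e.1.1 :=
    fun hA hn e he hr => hside (hr.trans ((hA.reachable_deleteEdges hG hCD hn).2 e he).symm)
  have key := fun X => TailCondition.prod_eq (X := X) hc h hα' hCD ht
  have path : ∀ {r : V} {A : Finset (Link G)}, r ∈ R → LinkPath G D r A →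
      ∀ s ∈ S, ∀ Q, LinkPath G s C Q →
        Observable hG S R c (Q ∪ insert ⟨(C, D), hCD⟩ A) :=
    fun hr hA s hs Q hQ => (hQ.trans (hA.head hCD)).observable hG hc hs hr
  suffices ∏ e ∈ {(⟨(C, D), hCD⟩ : Link G)}, α e = ∏ e ∈ {(⟨(C, D), hCD⟩ : Link G)}, α' e by
    simpa using this
  rcases hh with hD | ⟨r₁, hr₁, r₂, hr₂, -, p₁, p₂, hp₁, hp₂, hdisj, hn₁, hn₂⟩ |
    ⟨s', hs', r, hr, p₁, p₂, hp₁, hp₂, hn₁, hn₂⟩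
  · refine key _ (by simp) fun s hs Q hQ => ?_
    simpa using path hD .refl s hs Q hQ
  · obtain ⟨A₁, hA₁, hm₁⟩ := LinkPath.of_isDiPath hp₁
    obtain ⟨A₂, hA₂, hm₂⟩ := LinkPath.of_isDiPath hp₂
    have hn₁' : ⟨(C, D), hCD⟩ ∉ A₁ := fun he => hn₁ ((hm₁ _).mp he)
    have hn₂' : ⟨(C, D), hCD⟩ ∉ A₂ := fun he => hn₂ ((hm₂ _).mp he)
    have hd : A₁ ∩ A₂ = ∅ := by
      rw [← Finset.disjoint_iff_inter_eq_empty, Finset.disjoint_left]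
      intro e he₁ he₂
      exact hdisj ((hm₁ e).mp he₁) ((hm₂ e).mp he₂)
    have x₁ : ∀ e ∈ insert (⟨(C, D), hCD⟩ : Link G) A₁, e = ⟨(C, D), hCD⟩ ∨
        ¬ (G.toSimpleGraphInclusive.deleteEdges {s(C, D)}).Reachable C e.1.1 :=
      fun e he => (Finset.mem_insert.mp he).imp_right (side hA₁ hn₁' e)
    have x₂ : ∀ e ∈ insert (⟨(C, D), hCD⟩ : Link G) A₂, e = ⟨(C, D), hCD⟩ ∨
        ¬ (G.toSimpleGraphInclusive.deleteEdges {s(C, D)}).Reachable C e.1.1 :=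
      fun e he => (Finset.mem_insert.mp he).imp_right (side hA₂ hn₂' e)
    -- Two downstream branches, each extended by `CD`, meet in `CD` alone.
    have := prod_inter_eq hα' (key _ x₁ (path hr₁ hA₁)) (key _ x₂ (path hr₂ hA₂))
      (key _ (fun e he => (Finset.mem_union.mp he).elim (x₁ e) (x₂ e)) fun s hs Q hQ => by
        rw [Finset.union_union_distrib_left]
        exact (path hr₁ hA₁ s hs Q hQ).union (path hr₂ hA₂ s hs Q hQ))
    rwa [← Finset.insert_inter_distrib, hd] at this
  · obtain ⟨B, hB, hmB⟩ := LinkPath.of_isDiPath hp₁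
    obtain ⟨A, hA, hmA⟩ := LinkPath.of_isDiPath hp₂
    have hB' : ⟨(C, D), hCD⟩ ∉ B := fun he => hn₁ ((hmB _).mp he)
    have hA' : ⟨(C, D), hCD⟩ ∉ A := fun he => hn₂ ((hmA _).mp he)
    have oY := (hB.trans hA).observable hG hc hs' hr
    refine prod_eq_of_disjoint hα' (N := B ∪ A) (by simp [hB', hA']) (oY.prod_eq h)
      (key _ ?_ fun s hs Q hQ => ?_)
    · intro e he
      rw [Finset.mem_union, Finset.mem_singleton, Finset.mem_union] at he
      rcases he with he | he | he
      · exact .inl he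
      · obtain ⟨h₁, h₂⟩ := hB.reachable_deleteEdges hG hCD hB'
        exact .inr fun hr => hside (hr.trans ((h₂ e he).symm.trans h₁))
      · exact .inr (side hA hA' e he)
    · have e : Q ∪ ({⟨(C, D), hCD⟩} ∪ (B ∪ A)) = Q ∪ insert ⟨(C, D), hCD⟩ A ∪ (B ∪ A) := by
        ext; simp; tauto
      rw [e]
      exact (path hr hA s hs Q hQ).union oY

end Sufficiency

/-! ### Failure of either condition destroys identifiability. -/

section Necessity

variable {V F : Type*} [Fintype V] [DecidableEq V] [Field F] [DecidableEq F]
  {G : Digraph V} [DecidableRel G.Adj] {hG : IsDirectedTree G} {S R : Finset V} {c : V → V → F}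

theorem update_one_half_mem_Ioc {ι : Type*} [DecidableEq ι] (l l' : ι) :
    Function.update (fun _ => (1 : ℝ)) l (1 / 2) l' ∈ Set.Ioc (0 : ℝ) 1 := by
  rw [Function.update_apply]
  split_ifs <;> norm_num

/-- A link that lies on no path from a source to a receiver is not identifiable. -/
theorem not_isIdentifiable_of_unused (hc : ∀ u v : V, G.Adj u v → c u v ≠ 0) (l : Link G)
    (hl : ∀ s ∈ S, ∀ r ∈ R, ∀ M, LinkPath G s r M → l ∉ M) :
    ¬ IsIdentifiable G hG S R c l := by
  intro hid
  have key : ∀ α : Link G → ℝ, (∀ e, e ≠ l → α e = 1) → ∀ x, obsProb G hG S R c α x =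
      if observation G hG S R c (fun _ => true) = x then 1 else 0 := by
    intro α hα x
    trans ∑ W, if observation G hG S R c (fun _ => true) = x then stateProb G α W else 0
    · refine Finset.sum_congr rfl fun W _ => ?_
      -- If another link fails, the state has probability 0; otherwise only `l` can fail, which no
      -- observed path notices.
      by_cases hW : ∀ e, e ≠ l → W e = true
      · rw [observation_congr hG hc (W := W) (W' := fun _ => true)]
        intro s hs r hr M hM
        simp only [implies_true, iff_true]
        intro e he
        exact hW e fun h => hl s hs r hr M hM (h ▸ he)
      · push Not at hW
        obtain ⟨e, he, hWe⟩ := hW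
        have : stateProb G α W = 0 :=
          Finset.prod_eq_zero (Finset.mem_univ e) (by simp [hWe, hα e he])
        simp [this]
    · split_ifs
      · exact sum_stateProb α
      · simp
  have := hid (Function.update (fun _ => 1) l (1 / 2)) (fun _ => 1)
    (update_one_half_mem_Ioc l) (by simp) (funext fun x => by
      rw [key _ (fun e he => Function.update_of_ne he _ _), key _ (fun _ _ => rfl)])
  norm_num at this

/-- Two links that lie on the same paths from sources to receivers cannot be told apart. -/
theorem not_isIdentifiable_of_twin (hc : ∀ u v : V, G.Adj u v → c u v ≠ 0) {l l' : Link G}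
    (hne : l' ≠ l) (hl : ∀ s ∈ S, ∀ r ∈ R, ∀ M, LinkPath G s r M → (l ∈ M ↔ l' ∈ M)) :
    ¬ IsIdentifiable G hG S R c l := by
  intro hid
  have := hid (Function.update (fun _ => 1) l (1 / 2))
    (Function.update (fun _ => 1) l (1 / 2) ∘ Equiv.swap l l')
    (update_one_half_mem_Ioc l) (fun e => update_one_half_mem_Ioc l _) (funext fun x => by
      -- Swapping the states of the two links preserves the observation and exchanges the two
      -- parameter choices.
      refine Fintype.sum_equiv (Equiv.arrowCongr (Equiv.swap l l') (Equiv.refl Bool)) _ _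
        fun W => ?_
      have hobs : observation G hG S R c
          (Equiv.arrowCongr (Equiv.swap l l') (Equiv.refl Bool) W) =
          observation G hG S R c W := by
        refine observation_congr hG hc fun s hs r hr M hM => ?_
        have hmem : ∀ e, Equiv.swap l l' e ∈ M ↔ e ∈ M := by
          intro e
          have := hl s hs r hr M hM
          rw [Equiv.swap_apply_def]
          split_ifs with h₁ h₂
          · rw [h₁, this]
          · rw [h₂, this]
          · rfl
        refine ⟨fun h e he => ?_, fun h e he => ?_⟩
        · simpa using h _ ((hmem e).mpr he)
        · simpa using h _ ((hmem e).mpr he)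
      have hprob : stateProb G (Function.update (fun _ => 1) l (1 / 2) ∘ Equiv.swap l l')
          (Equiv.arrowCongr (Equiv.swap l l') (Equiv.refl Bool) W) =
          stateProb G (Function.update (fun _ => 1) l (1 / 2)) W := by
        refine Fintype.prod_equiv (Equiv.swap l l') _ _ fun e => ?_
        simp
      rw [hobs, hprob])
  rw [Function.comp_apply, Equiv.swap_apply_left, Function.update_self,
    Function.update_of_ne hne] at this
  norm_num at this

/-- When the condition fails and `CD` is used, the twin is the link `BC` by which a source reaches
`C`: a second entry link would give (b), and a source-receiver path through `BC` leaving `C`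
otherwise would give (c). -/
theorem tailCondition_of_isIdentifiable (hc : ∀ u v : V, G.Adj u v → c u v ≠ 0) {C D : V}
    (hCD : G.Adj C D) (hid : IsIdentifiable G hG S R c ⟨(C, D), hCD⟩) :
    TailCondition G S R C D := by
  by_contra ht
  rw [TailCondition, not_or, not_or] at ht
  obtain ⟨hC, hb, hc'⟩ := ht
  have avoid : ∀ {s : V} {M : Finset (Link G)}, LinkPath G s C M → ⟨(C, D), hCD⟩ ∉ M := by
    intro s M hM he
    obtain ⟨-, M₂, -, h₂, -⟩ := hM.split he
    exact hG.not_adj_of_reflTransGen h₂.reflTransGen hCD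
  by_cases hu : ∀ s ∈ S, ∀ r ∈ R, ∀ M, LinkPath G s r M → ⟨(C, D), hCD⟩ ∉ M
  · exact not_isIdentifiable_of_unused hc _ hu hid
  push Not at hu
  obtain ⟨i, hi, r₀, hr₀, N, hN, hmem⟩ := hu
  obtain ⟨M, -, hM, -, -⟩ := hN.split hmem
  obtain _ | @⟨B, _, M', hB, hBC⟩ := hM
  · exact hC hi
  refine not_isIdentifiable_of_twin hc (l' := ⟨(B, C), hBC⟩) ?_ ?_ hid
  · intro h
    have := congrArg (fun e : Link G => e.1.2) h
    simp only at this
    subst this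
    exact hG.asymm _ _ hCD hCD
  intro s hs r hr P hP
  constructor
  · intro he
    obtain ⟨P₁, P₂, h₁, -, rfl⟩ := hP.split he
    simp only at h₁
    obtain _ | @⟨B', _, P', hB', hBC'⟩ := h₁
    · exact absurd hs hC
    by_cases hBB : B = B'
    · subst hBB; simp
    exfalso
    have hi' := hB.tail hBC
    have hs' := hB'.tail hBC'
    obtain ⟨p₁, hp₁, hm₁⟩ := hi'.exists_isDiPath hG
    obtain ⟨p₂, hp₂, hm₂⟩ := hs'.exists_isDiPath hG
    refine hb ⟨i, hi, s, hs, ?_, p₁, p₂, hp₁, hp₂, ?_, ?_, ?_⟩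
    · rintro rfl
      exact hBB (hG.pred_unique hB.reflTransGen hBC hB'.reflTransGen hBC')
    -- A shared link either closes a directed cycle or lets its head reach `C` through both `B` and
    -- `B'`, against `pred_unique`.
    · intro x hx₁ hx₂
      obtain ⟨e, he₁, rfl⟩ := hm₁ x hx₁
      obtain ⟨e', he₂, hee⟩ := hm₂ _ hx₂
      obtain rfl := Subtype.ext hee
      rcases Finset.mem_insert.mp he₁ with rfl | he₁
      · rcases Finset.mem_insert.mp he₂ with h | he₂
        · exact hBB (congrArg (fun e : Link G => e.1.1) h)
        · obtain ⟨-, _, -, h₂, -⟩ := hB'.split he₂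
          exact hG.not_adj_of_reflTransGen h₂.reflTransGen hBC'
      · obtain ⟨-, _, -, h₁, -⟩ := hB.split he₁
        rcases Finset.mem_insert.mp he₂ with rfl | he₂
        · exact hG.not_adj_of_reflTransGen h₁.reflTransGen hBC
        · obtain ⟨-, _, -, h₂, -⟩ := hB'.split he₂
          exact hBB (hG.pred_unique h₁.reflTransGen hBC h₂.reflTransGen hBC')
    · intro hx
      obtain ⟨e, he, hee⟩ := hm₁ _ hx
      exact avoid hi' ((Subtype.ext hee : e = ⟨(C, D), hCD⟩) ▸ he)
    · intro hx
      obtain ⟨e, he, hee⟩ := hm₂ _ hx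
      exact avoid hs' ((Subtype.ext hee : e = ⟨(C, D), hCD⟩) ▸ he)
  · intro he
    obtain ⟨P₁, P₂, h₁, h₂, rfl⟩ := hP.split he
    by_contra hne
    have hs' := h₁.tail hBC
    obtain ⟨p₁, hp₁, hm₁⟩ := hs'.exists_isDiPath hG
    obtain ⟨p₂, hp₂, hm₂⟩ := h₂.exists_isDiPath hG
    refine hc' ⟨s, hs, r, hr, p₁, p₂, hp₁, hp₂, ?_, ?_⟩
    · intro hx
      obtain ⟨e, he, hee⟩ := hm₁ _ hx
      exact avoid hs' ((Subtype.ext hee : e = ⟨(C, D), hCD⟩) ▸ he)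
    · intro hx
      obtain ⟨e, he, hee⟩ := hm₂ _ hx
      obtain rfl : e = ⟨(C, D), hCD⟩ := Subtype.ext hee
      exact hne (by simp [he])

/-- The mirror image: the twin is the link `DB` that begins the way from `D` to a receiver, and
`succ_unique` replaces `pred_unique`. -/
theorem headCondition_of_isIdentifiable (hc : ∀ u v : V, G.Adj u v → c u v ≠ 0) {C D : V}
    (hCD : G.Adj C D) (hid : IsIdentifiable G hG S R c ⟨(C, D), hCD⟩) :
    HeadCondition G S R C D := by
  by_contra ht
  rw [HeadCondition, not_or, not_or] at ht
  obtain ⟨hD, hb, hc'⟩ := ht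
  have avoid : ∀ {r : V} {M : Finset (Link G)}, LinkPath G D r M → ⟨(C, D), hCD⟩ ∉ M := by
    intro r M hM he
    obtain ⟨M₁, -, h₁, -, -⟩ := hM.split he
    exact hG.not_adj_of_reflTransGen h₁.reflTransGen hCD
  by_cases hu : ∀ s ∈ S, ∀ r ∈ R, ∀ M, LinkPath G s r M → ⟨(C, D), hCD⟩ ∉ M
  · exact not_isIdentifiable_of_unused hc _ hu hid
  push Not at hu
  obtain ⟨s₀, hs₀, i, hi, N, hN, hmem⟩ := hu
  obtain ⟨-, M, -, hM, -⟩ := hN.split hmem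
  obtain ⟨rfl, -⟩ | ⟨B, M', hDB, hB, -⟩ := hM.eq_or_exists_head
  · exact hD hi
  refine not_isIdentifiable_of_twin hc (l' := ⟨(D, B), hDB⟩) ?_ ?_ hid
  · intro h
    have := congrArg (fun e : Link G => e.1.1) h
    simp only at this
    subst this
    exact hG.asymm _ _ hCD hCD
  intro s hs r hr P hP
  constructor
  · intro he
    obtain ⟨P₁, P₂, -, h₂, rfl⟩ := hP.split he
    simp only at h₂
    obtain ⟨rfl, -⟩ | ⟨B', P', hDB', hB', rfl⟩ := h₂.eq_or_exists_head
    · exact absurd hr hD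
    by_cases hBB : B = B'
    · subst hBB; simp
    exfalso
    have hi' := hB.head hDB
    have hr' := hB'.head hDB'
    obtain ⟨p₁, hp₁, hm₁⟩ := hi'.exists_isDiPath hG
    obtain ⟨p₂, hp₂, hm₂⟩ := hr'.exists_isDiPath hG
    refine hb ⟨i, hi, r, hr, ?_, p₁, p₂, hp₁, hp₂, ?_, ?_, ?_⟩
    · rintro rfl
      exact hBB (hG.succ_unique hDB hB.reflTransGen hDB' hB'.reflTransGen)
    · intro x hx₁ hx₂
      obtain ⟨e, he₁, rfl⟩ := hm₁ x hx₁
      obtain ⟨e', he₂, hee⟩ := hm₂ _ hx₂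
      obtain rfl := Subtype.ext hee
      rcases Finset.mem_insert.mp he₁ with rfl | he₁
      · rcases Finset.mem_insert.mp he₂ with h | he₂
        · exact hBB (congrArg (fun e : Link G => e.1.2) h)
        · obtain ⟨_, -, h₂, -, -⟩ := hB'.split he₂
          exact hG.not_adj_of_reflTransGen h₂.reflTransGen hDB'
      · obtain ⟨_, -, h₁, -, -⟩ := hB.split he₁
        rcases Finset.mem_insert.mp he₂ with rfl | he₂
        · exact hG.not_adj_of_reflTransGen h₁.reflTransGen hDB
        · obtain ⟨_, -, h₂, -, -⟩ := hB'.split he₂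
          exact hBB (hG.succ_unique hDB h₁.reflTransGen hDB' h₂.reflTransGen)
    · intro hx
      obtain ⟨e, he, hee⟩ := hm₁ _ hx
      exact avoid hi' ((Subtype.ext hee : e = ⟨(C, D), hCD⟩) ▸ he)
    · intro hx
      obtain ⟨e, he, hee⟩ := hm₂ _ hx
      exact avoid hr' ((Subtype.ext hee : e = ⟨(C, D), hCD⟩) ▸ he)
  · intro he
    obtain ⟨P₁, P₂, h₁, h₂, rfl⟩ := hP.split he
    by_contra hne
    have hr' := h₂.head hDB
    obtain ⟨p₁, hp₁, hm₁⟩ := h₁.exists_isDiPath hG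
    obtain ⟨p₂, hp₂, hm₂⟩ := hr'.exists_isDiPath hG
    refine hc' ⟨s, hs, r, hr, p₁, p₂, hp₁, hp₂, ?_, ?_⟩
    · intro hx
      obtain ⟨e, he, hee⟩ := hm₁ _ hx
      obtain rfl : e = ⟨(C, D), hCD⟩ := Subtype.ext hee
      exact hne (by simp [he])
    · intro hx
      obtain ⟨e, he, hee⟩ := hm₂ _ hx
      exact avoid hr' ((Subtype.ext hee : e = ⟨(C, D), hCD⟩) ▸ he)

end Necessity

end LossTomography

theorem theorem1 {V F : Type*} [Fintype V] [DecidableEq V] [Field F] [DecidableEq F]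
    (G : Digraph V) [DecidableRel G.Adj] (hG : LossTomography.IsDirectedTree G)
    (S R : Finset V) (c : V → V → F) (hc : ∀ u v : V, G.Adj u v → c u v ≠ 0)
    (C D : V) (hCD : G.Adj C D) :
    LossTomography.IsIdentifiable G hG S R c ⟨(C, D), hCD⟩ ↔
      LossTomography.TailCondition G S R C D ∧ LossTomography.HeadCondition G S R C D :=
  ⟨fun h => ⟨LossTomography.tailCondition_of_isIdentifiable hc hCD h,
    LossTomography.headCondition_of_isIdentifiable hc hCD h⟩,
    fun h => LossTomography.isIdentifiable_of_conditions hc hCD h.1 h.2⟩
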